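/- **The cooperative network creation game.** Let $H=(V,E)$ be a host graph on $n$ vertices (the players) and let $\alpha\ge 0$ be the cost of a link. A joint strategy $s$ assigns to every player $i$ and every edge $e\in E$ an amount $s(i,e)\ge 0$ that $i$ is willing to pay for $e$. The created graph $G_s=(V,E_s)$ has the edges $e$ with $\sum_{k\in V}s(k,e)\ge\alpha$. For $e\in E_s$, player $i$ pays $s'(i,e)=\alpha\, s(i,e)/\sum_{k\in V}s(k,e)$, so that the payments for $e$ sum to $\alpha$; nothing is paid for edges that are not created. The cost of player $i$ is $$c_i(s)=\sum_{e\in E_s}s'(i,e)+\sum_{j\in V}d_{G_s}(i,j),$$ where $d_{G_s}(i,j)=\infty$ if $i$ and $j$ are not connected in $G_s$, and the total cost is $c(s)=\alpha|E_s|+\sum_{i,j\in V}d_{G_s}(i,j)$. A joint strategy $s$ is a collaborative equilibrium if for every edge $e\in E$, every nonempty coalition $C\subseteq V$, and every joint strategy $t$ that differs from $s$ at most in the values $t(i,e)$ with $i\in C$, some player $i\in C$ has $c_i(t)\ge c_i(s)$; that is, no coalition can change its offers for a single edge so that all its members strictly gain. The price of anarchy is the supremum of $c(s)$ over the collaborative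 equilibria $s$ with connected $G_s$ (equivalently, of finite total cost), divided by the social optimum $\inf_s c(s)$ over all joint strategies. **Corollary.** Write $\lg=\log_2$. For every constant $c>0$ there is a constant $K$, depending only on $c$, such that for every integer $n\ge 2$ and every $\alpha\ge c\, n\,(\lg n)^{2+2\lg 6}$, the price of anarchy of the cooperative network creation game on the complete host graph on $n$ vertices is at most $K$. In other words, for $\alpha=\Omega(n\lg^{2+2\lg 6}n)$ (the exponent is about $7.17$), the price of anarchy is $O(1)$. -/

import Mathlib

open scoped NNReal ENNReal

noncomputable section

namespace NetworkCreation

/-- A joint strategy of the cooperative game on the host graph `H`: the value `s i e` is the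
(nonnegative) amount that player `i` is willing to pay for the link `e`, an edge of `H`. -/
abbrev JointStrategy {V : Type*} (H : SimpleGraph V) : Type _ :=
  V → H.edgeSet → ℝ≥0

/-- The total amount offered for the edge `e`. -/
def totalBid {V : Type*} [Fintype V] {H : SimpleGraph V}
    (s : JointStrategy H) (e : H.edgeSet) : ℝ≥0 :=
  ∑ i : V, s i e

/-- The set `E_s` of created edges: those for which at least `α` is offered in total. -/
def createdEdges {V : Type*} [Fintype V] {H : SimpleGraph V}
    (α : ℝ≥0) (s : JointStrategy H) : Set (Sym2 V) :=
  {e | ∃ h : e ∈ H.edgeSet, α ≤ totalBid s ⟨e, h⟩}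

/-- The created network `G_s`, a spanning subgraph of the host graph. -/
def createdGraph {V : Type*} [Fintype V] {H : SimpleGraph V}
    (α : ℝ≥0) (s : JointStrategy H) : SimpleGraph V :=
  SimpleGraph.fromEdgeSet (createdEdges α s)

open Classical in
/-- What player `i` really pays for the edge `e`: nothing if `e` is not created; otherwise the
offers are scaled uniformly so that they sum to `α` (if they sum to exactly `α`, then this is
`s i e` itself). -/
def payment {V : Type*} [Fintype V] {H : SimpleGraph V}
    (α : ℝ≥0) (s : JointStrategy H) (i : V) (e : H.edgeSet) : ℝ≥0 :=
  if α ≤ totalBid s e then α * s i e / totalBid s e else 0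

/-- Sum of the distances from `i` to all vertices of `G_s`; it is infinite when some vertex
cannot be reached from `i`. -/
def usageCost {V : Type*} [Fintype V] {H : SimpleGraph V}
    (α : ℝ≥0) (s : JointStrategy H) (i : V) : ℝ≥0∞ :=
  ∑ j : V, ((createdGraph α s).edist i j : ℝ≥0∞)

open Classical in
/-- The cost `c_i(s)` of player `i`: payments for created edges plus usage cost. -/
def playerCost {V : Type*} [Fintype V] {H : SimpleGraph V}
    (α : ℝ≥0) (s : JointStrategy H) (i : V) : ℝ≥0∞ :=
  ∑ e : H.edgeSet, (payment α s i e : ℝ≥0∞) + usageCost α s i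

/-- The total cost `c(s) = α |E_s| + ∑ i, ∑ j, d(i, j)`. -/
def totalCost {V : Type*} [Fintype V] {H : SimpleGraph V}
    (α : ℝ≥0) (s : JointStrategy H) : ℝ≥0∞ :=
  (α : ℝ≥0∞) * ((createdEdges α s).ncard : ℝ≥0∞) + ∑ i : V, usageCost α s i

/-- `s'` differs from `s` at most in the offers of members of `C` for the single edge `e`. -/
def IsDeviation {V : Type*} {H : SimpleGraph V}
    (s s' : JointStrategy H) (e : H.edgeSet) (C : Finset V) : Prop :=
  ∀ (i : V) (f : H.edgeSet), ¬ (i ∈ C ∧ f = e) → s' i f = s i f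

/-- Collaborative equilibrium: no nonempty coalition can change its offers for one single edge
of the host graph in such a way that every member of the coalition becomes strictly better off.
(Coalitions are blocked by a member who does not gain. Requiring a member who strictly loses
would be unsatisfiable, since raising an offer for an edge that stays unbuilt changes no cost.) -/
def IsCollaborativeEquilibrium {V : Type*} [Fintype V] {H : SimpleGraph V}
    (α : ℝ≥0) (s : JointStrategy H) : Prop :=
  ∀ (e : H.edgeSet) (C : Finset V), C.Nonempty → ∀ s' : JointStrategy H,
    IsDeviation s s' e C → ∃ i ∈ C, playerCost α s i ≤ playerCost α s' i

/-- The social optimum: the minimum total cost of a joint strategy. -/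
def socialOptimum {V : Type*} [Fintype V] (H : SimpleGraph V) (α : ℝ≥0) : ℝ≥0∞ :=
  ⨅ s : JointStrategy H, totalCost α s

/-- The price of anarchy: the maximum total cost of a collaborative equilibrium divided by the
social optimum. Equilibria are understood to create a connected network, that is, to have
finite cost (three or more components would otherwise be a degenerate equilibrium, in which
everybody's cost is infinite and no single edge makes it finite). -/
def priceOfAnarchy {V : Type*} [Fintype V] (H : SimpleGraph V) (α : ℝ≥0) : ℝ≥0∞ :=
  (⨆ (s : JointStrategy H) (_ : IsCollaborativeEquilibrium α s)
    (_ : (createdGraph α s).Connected), totalCost α s) / socialOptimum H α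

end NetworkCreation

end

/-! Equilibrium enters only through two inequalities for the sum D of all distances in the created
graph. Adding a missing edge lowers D by at most α, since otherwise the players who gain could share
its price in proportion to their gains (`addStable`). Deleting an edge that is not a bridge raises D
by at least α, since otherwise somebody pays more for it than it is worth to them (`deleteStable`).

The first inequality bounds the diameter. Suppose that every ball of radius k has at least Y
vertices and put X = (k - 1)Yn/(2α). If no ball of radius 5k holds more than half of the vertices,
balls of radius 6k have at least XY vertices (`exists_separated_shell`), so X is at least squared
while the radius grows sixfold. Starting from X ≥ 2 at k of order √(α/n), about lg lg n rounds
exhaust the graph; a ball with more than half of the vertices bounds the diameter even earlier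
(`dist_le_of_large_ball`). Distances are thus O(√(α/n) (lg n)^(lg 6)), which the hypothesis on α
turns into O(α/(n lg n)).

The second inequality bounds the number of edges. An edge with a detour of length at most ℓ occurs
at least α/ℓ times in a system of geodesics, so there are at most ℓD/α such edges
(`mul_card_shortEdges_le`). For a suitable ℓ = O(lg n), all but 2n edges are of this kind
(`card_edgeFinset_le_card_shortEdges`). Hence α|E| + D ≤ 2αn + O(lg n)·D = O(αn), while the optimum
is at least α(n - 1). -/

noncomputable section

namespace SimpleGraph

variable {V : Type*}

/-! ### Geodesics and the deletion of one edge -/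

/-- On a geodesic there is a vertex at every intermediate distance. -/
theorem Connected.exists_dist_eq_of_le {G : SimpleGraph V} (hG : G.Connected) {u w : V} {m : ℕ}
    (hm : m ≤ G.dist u w) : ∃ x, G.dist u x = m ∧ G.dist u x + G.dist x w = G.dist u w := by
  obtain ⟨p, hp⟩ := hG.exists_walk_length_eq_dist u w
  have h1 : G.dist u (p.getVert m) ≤ m :=
    (dist_le (p.take m)).trans (by simp)
  have h2 : G.dist (p.getVert m) w ≤ G.dist u w - m :=
    (dist_le (p.drop m)).trans (by simp [hp])
  have h3 := hG.dist_triangle (u := u) (v := p.getVert m) (w := w)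
  exact ⟨p.getVert m, by omega, by omega⟩

/-- A detour of length at most `ℓ` around an edge `ab` bounds the distances after the deletion
of `ab`. -/
theorem edist_deleteEdges_le [DecidableEq V] {G : SimpleGraph V} {a b : V} {ℓ : ℕ}
    (hd : (G.deleteEdges {s(a, b)}).edist a b ≤ ℓ) {x y : V} (p : G.Walk x y) :
    (G.deleteEdges {s(a, b)}).edist x y ≤ (p.length + ℓ * p.edges.count s(a, b) : ℕ) := by
  induction p with
  | nil => simp
  | @cons u v w huv p ih =>
    refine (SimpleGraph.edist_triangle (v := v)).trans ?_
    have h1 : (G.deleteEdges {s(a, b)}).edist u v ≤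
        (1 + ℓ * (if s(u, v) = s(a, b) then 1 else 0) : ℕ) := by
      split_ifs with h
      · have : (G.deleteEdges {s(a, b)}).edist u v ≤ ℓ := by
          rcases Sym2.eq_iff.1 h with ⟨rfl, rfl⟩ | ⟨rfl, rfl⟩
          · exact hd
          · rwa [edist_comm]
        refine this.trans ?_
        norm_cast
        omega
      · have : (G.deleteEdges {s(a, b)}).Adj u v := by
          rw [deleteEdges_adj]
          exact ⟨huv, by simpa using h⟩
        simp [edist_eq_one_iff_adj.2 this]
    refine (add_le_add h1 ih).trans ?_
    rw [Walk.length_cons, Walk.edges_cons, List.count_cons]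
    norm_cast
    simp only [beq_iff_eq]
    split_ifs <;> simp <;> linarith

theorem connected_of_edist_ne_top [Nonempty V] {G : SimpleGraph V}
    (h : ∀ x y, G.edist x y ≠ ⊤) : G.Connected :=
  ⟨fun x y => edist_ne_top_iff_reachable.1 (h x y)⟩

/-- A geodesic avoids the edges at a vertex `y` that is not closer to its initial vertex than its
end. -/
theorem edist_deleteEdges_le_edist {H : SimpleGraph V} {u x y z : V}
    (hzy : z ≠ y) (h : H.edist u z ≤ H.edist u y) :
    (H.deleteEdges {s(x, y)}).edist u z ≤ H.edist u z := by
  classical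
  by_cases htop : H.edist u z = ⊤
  · simp [htop]
  obtain ⟨p, hp⟩ := (edist_ne_top_iff_reachable.1 htop).exists_walk_length_eq_edist
  have hy : y ∉ p.support := by
    intro hy
    have h1 := p.length_takeUntil_lt_length hy hzy.symm
    have h2 : H.edist u y ≤ (p.takeUntil y hy).length := edist_le _
    have h3 : ((p.takeUntil y hy).length : ℕ∞) < p.length := by exact_mod_cast h1
    exact absurd (hp ▸ (h.trans h2).trans_lt h3) (lt_irrefl _)
  have he : ∀ e ∈ p.edges, e ∉ ({s(x, y)} : Set (Sym2 V)) := by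
    rintro e he rfl
    exact hy (p.snd_mem_support_of_mem_edges he)
  refine (edist_le (p.toDeleteEdges _ he)).trans ?_
  rw [← hp]
  simp [Walk.toDeleteEdges]

variable [Fintype V]

/-! ### Distance sums, balls and stability -/

/-- The sum of the distances over all ordered pairs of vertices. -/
def distSum (G : SimpleGraph V) : ℕ := ∑ i : V, ∑ j : V, G.dist i j

open Classical in
/-- The vertices at distance at most `r` from `u`. -/
def distBall (G : SimpleGraph V) (r : ℕ) (u : V) : Finset V :=
  Finset.univ.filter fun v => G.dist u v ≤ r

@[simp] theorem mem_distBall {G : SimpleGraph V} {r : ℕ} {u v : V} :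
    v ∈ G.distBall r u ↔ G.dist u v ≤ r := by
  simp [distBall]

/-- Adding any missing edge lowers the sum of distances by at most `α`. -/
def AddStable (G : SimpleGraph V) (α : ℝ) : Prop :=
  ∀ a b, a ≠ b → ¬ G.Adj a b → (G.distSum : ℝ) ≤ α + (G ⊔ edge a b).distSum

/-- Deleting any edge that is not a bridge raises the sum of distances by at least `α`. -/
def DeleteStable (G : SimpleGraph V) (α : ℝ) : Prop :=
  ∀ a b, G.Adj a b → (G.deleteEdges {s(a, b)}).Connected →
    (G.distSum : ℝ) + α ≤ (G.deleteEdges {s(a, b)}).distSum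

/-- If a new edge `ab` brings all members of `P` closer by `g` to all members of `Q`, then
`g * |P| * |Q| ≤ α`. -/
theorem AddStable.mul_card_mul_card_le {G : SimpleGraph V} {α : ℝ} (h : G.AddStable α)
    (hG : G.Connected) {a b : V} (hab : a ≠ b) (hadj : ¬ G.Adj a b) {P Q : Finset V} {g : ℕ}
    (hg : ∀ p ∈ P, ∀ q ∈ Q, G.dist p a + 1 + G.dist b q + g ≤ G.dist p q) :
    (g * P.card * Q.card : ℝ) ≤ α := by
  classical
  set G' := G ⊔ edge a b with hG'
  have hle : G ≤ G' := le_sup_left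
  have hconn : G'.Connected := hG.mono hle
  have hanti : ∀ x y, G'.dist x y ≤ G.dist x y := fun x y => (hG x y).dist_anti hle
  have hab' : G'.dist a b = 1 := by
    rw [dist_eq_one_iff_adj, hG', sup_adj, edge_adj]
    exact Or.inr ⟨Or.inl ⟨rfl, rfl⟩, hab⟩
  have key : ∀ x y, G'.dist x y + (if x ∈ P ∧ y ∈ Q then g else 0) ≤ G.dist x y := by
    intro x y
    split_ifs with hxy
    · have h1 := hg x hxy.1 y hxy.2
      have h2 := hconn.dist_triangle (u := x) (v := a) (w := y)
      have h3 := hconn.dist_triangle (u := a) (v := b) (w := y)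
      have h4 := hanti x a
      have h5 := hanti b y
      omega
    · simpa using hanti x y
  -- Only the ordered pairs in P × Q are credited with the gain; the reversed pairs would merely
  -- improve a constant.
  have hsum : G'.distSum + g * P.card * Q.card ≤ G.distSum := by
    have h1 : ∑ x : V, ∑ y : V, (if x ∈ P ∧ y ∈ Q then g else 0) = g * P.card * Q.card := by
      simp only [ite_and, Finset.sum_ite_irrel, Finset.sum_const_zero, Finset.sum_ite_mem,
        Finset.univ_inter, Finset.sum_const, smul_eq_mul]
      ring
    rw [← h1, distSum, distSum, ← Finset.sum_add_distrib]
    refine Finset.sum_le_sum fun x _ => ?_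
    rw [← Finset.sum_add_distrib]
    exact Finset.sum_le_sum fun y _ => key x y
  have h2 := h a b hab hadj
  have h3 : (G'.distSum : ℝ) + g * P.card * Q.card ≤ G.distSum := by exact_mod_cast hsum
  linarith

/-! ### Growth of balls and the diameter -/

/-- A vertex with a vertex at distance at least `k` has at least `k` vertices within distance
`k`. -/
theorem Connected.le_card_distBall {G : SimpleGraph V} (hG : G.Connected) {u w : V} {k : ℕ}
    (hk : k ≤ G.dist u w) : k ≤ (G.distBall k u).card := by
  have h : Set.SurjOn (G.dist u) (G.distBall k u) (Finset.range (k + 1)) := by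
    intro m hm
    have hm' : m ≤ k := by simpa [Nat.lt_succ_iff] using hm
    obtain ⟨x, hx, -⟩ := hG.exists_dist_eq_of_le (hm'.trans hk)
    exact ⟨x, by simpa [hx] using hm', hx⟩
  have := Finset.card_le_card_of_surjOn _ h
  simp at this
  omega

/-- A set of vertices at distance `5 * k` from `u`, pairwise more than `2 * k` apart, that comes
close to all geodesics leaving the ball of radius `5 * k` around `u`. -/
theorem AddStable.exists_separated_shell {G : SimpleGraph V} {α : ℝ} (h : G.AddStable α)
    (hG : G.Connected) {k Y : ℕ} (hk : 1 ≤ k) (hY : ∀ v, Y ≤ (G.distBall k v).card) {u : V}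
    (hu : 2 * (G.distBall (5 * k) u).card ≤ Fintype.card V) :
    ∃ T : Finset V, ((k - 1 : ℕ) * Y * Fintype.card V : ℝ) ≤ 2 * α * T.card ∧
      T.card * Y ≤ (G.distBall (6 * k) u).card := by
  classical
  -- A largest separated subset T of the sphere of radius 5k is also 2k-dense in that sphere.
  set F : Finset (Finset V) := Finset.univ.filter fun T =>
    (∀ t ∈ T, G.dist u t = 5 * k) ∧ ∀ t ∈ T, ∀ t' ∈ T, t ≠ t' → 2 * k < G.dist t t' with hF
  obtain ⟨T, hTF, hTmax⟩ := F.exists_max_image Finset.card ⟨∅, by simp [hF]⟩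
  obtain ⟨hT1, hT2⟩ : (∀ t ∈ T, G.dist u t = 5 * k) ∧
      ∀ t ∈ T, ∀ t' ∈ T, t ≠ t' → 2 * k < G.dist t t' := by simpa [hF] using hTF
  have hcover : ∀ x, G.dist u x = 5 * k → ∃ t ∈ T, G.dist t x ≤ 2 * k := by
    intro x hx
    by_contra! hcon
    have hxT : x ∉ T := fun hxT => by simpa using hcon x hxT
    have : insert x T ∈ F := by
      simp only [hF, Finset.mem_filter, Finset.mem_univ, true_and]
      refine ⟨fun t ht => ?_, fun t ht t' ht' hne => ?_⟩
      · rcases Finset.mem_insert.1 ht with rfl | ht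
        exacts [hx, hT1 t ht]
      · rcases Finset.mem_insert.1 ht with rfl | ht1 <;>
          rcases Finset.mem_insert.1 ht' with rfl | ht1'
        · exact absurd rfl hne
        · rw [dist_comm]; exact hcon _ ht1'
        · exact hcon _ ht1
        · exact hT2 _ ht1 _ ht1' hne
    have := hTmax _ this
    rw [Finset.card_insert_of_notMem hxT] at this
    omega
  refine ⟨T, ?_, ?_⟩
  -- The new edge ut shortens the way from the k-ball around u to W t by 3k - k - k - 1 = k - 1. A
  -- geodesic from u to a vertex outside the 5k-ball passes within 2k of some t, which saves 5k - 2k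
  -- = 3k; hence the sets W t cover at least half of the vertices.
  · set W : V → Finset V := fun t => Finset.univ.filter fun w =>
      G.dist t w + 3 * k ≤ G.dist u w with hW
    have hWα : ∀ t ∈ T, ((k - 1 : ℕ) * Y * (W t).card : ℝ) ≤ α := by
      intro t ht
      have hut := hT1 t ht
      have h1 : u ≠ t := by
        rintro rfl
        simp at hut
        omega
      have h2 : ¬ G.Adj u t := by
        intro h
        rw [← dist_eq_one_iff_adj] at h
        omega
      refine le_trans ?_ (h.mul_card_mul_card_le hG h1 h2 (P := G.distBall k u) (Q := W t)
        (g := k - 1) ?_)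
      · have := hY u
        gcongr
      · intro p hp q hq
        rw [mem_distBall] at hp
        have hq' : G.dist t q + 3 * k ≤ G.dist u q := by simpa [hW] using hq
        have h3 := hG.dist_triangle (u := u) (v := p) (w := q)
        rw [dist_comm] at hp
        have h4 : G.dist u p = G.dist p u := dist_comm
        omega
    have hcov : Finset.univ \ G.distBall (5 * k) u ⊆ T.biUnion W := by
      intro w hw
      have hw' : 5 * k < G.dist u w := by simpa using hw
      obtain ⟨x, hx1, hx2⟩ := hG.exists_dist_eq_of_le hw'.le
      obtain ⟨t, ht, htx⟩ := hcover x hx1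
      have h3 := hG.dist_triangle (u := t) (v := x) (w := w)
      refine Finset.mem_biUnion.2 ⟨t, ht, ?_⟩
      simp only [hW, Finset.mem_filter, Finset.mem_univ, true_and]
      omega
    have hcard : Fintype.card V ≤ 2 * ∑ t ∈ T, (W t).card := by
      have h1 := (Finset.card_le_card hcov).trans Finset.card_biUnion_le
      rw [Finset.card_sdiff_of_subset (Finset.subset_univ _), Finset.card_univ] at h1
      omega
    calc ((k - 1 : ℕ) * Y * Fintype.card V : ℝ)
        ≤ (k - 1 : ℕ) * Y * (2 * ∑ t ∈ T, (W t).card : ℕ) := by gcongr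
      _ = 2 * ∑ t ∈ T, ((k - 1 : ℕ) * Y * (W t).card : ℝ) := by
        push_cast
        rw [← Finset.mul_sum]
        ring
      _ ≤ 2 * ∑ t ∈ T, α := by
        gcongr with t ht
        exact hWα t ht
      _ = 2 * α * T.card := by
        rw [Finset.sum_const, nsmul_eq_mul]
        ring
  · have hdisj : (T : Set V).PairwiseDisjoint (G.distBall k) := by
      intro t ht t' ht' hne
      refine Finset.disjoint_left.2 fun x hx hx' => ?_
      rw [mem_distBall] at hx hx'
      have h1 := hT2 t ht t' ht' hne
      have h2 := hG.dist_triangle (u := t) (v := x) (w := t')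
      have h3 : G.dist x t' = G.dist t' x := dist_comm
      omega
    have hsub : T.biUnion (G.distBall k) ⊆ G.distBall (6 * k) u := by
      intro x hx
      obtain ⟨t, ht, hx⟩ := Finset.mem_biUnion.1 hx
      rw [mem_distBall] at hx ⊢
      have h1 := hT1 t ht
      have h2 := hG.dist_triangle (u := u) (v := t) (w := x)
      omega
    calc T.card * Y = ∑ t ∈ T, Y := by simp
      _ ≤ ∑ t ∈ T, (G.distBall k t).card := Finset.sum_le_sum fun t _ => hY t
      _ = (T.biUnion (G.distBall k)).card := (Finset.card_biUnion hdisj).symm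
      _ ≤ _ := Finset.card_le_card hsub

/-- A ball of radius `5 * k` containing half of the vertices bounds the diameter. -/
theorem AddStable.dist_le_of_large_ball {G : SimpleGraph V} {α : ℝ} (h : G.AddStable α)
    (hG : G.Connected) {k Y : ℕ} (hk : 1 ≤ k)
    (hY : ∀ v, Y ≤ (G.distBall k v).card)
    (hX : 2 * α < (k * Y * Fintype.card V : ℝ)) {u : V}
    (hu : Fintype.card V < 2 * (G.distBall (5 * k) u).card) (v w : V) :
    G.dist v w ≤ 26 * k := by
  -- If v is farther away, p and q below are at least 13k + 1 - 5k - k = 7k + 1 apart, while the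
  -- route through the edge uv has length at most 6k + 1: a gain of k.
  have main : ∀ v, G.dist u v ≤ 13 * k := by
    intro v
    by_contra! hv
    have h1 : u ≠ v := by
      rintro rfl
      simp at hv
    have h2 : ¬ G.Adj u v := by
      intro h
      rw [← dist_eq_one_iff_adj] at h
      omega
    have h3 := h.mul_card_mul_card_le hG h1 h2 (P := G.distBall (5 * k) u)
      (Q := G.distBall k v) (g := k) (by
        intro p hp q hq
        rw [mem_distBall] at hp hq
        have h3 := hG.dist_triangle (u := u) (v := p) (w := v)
        have h4 := hG.dist_triangle (u := p) (v := q) (w := v)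
        have h5 : G.dist q v = G.dist v q := dist_comm
        have h6 : G.dist p u = G.dist u p := dist_comm
        omega)
    have h4 : (k * (G.distBall (5 * k) u).card * Y : ℝ) ≤ α := by
      refine le_trans ?_ h3
      have := hY v
      gcongr
    have h5 : (Fintype.card V : ℝ) ≤ 2 * (G.distBall (5 * k) u).card := by exact_mod_cast hu.le
    have h6 : (k * Y * Fintype.card V : ℝ) ≤ k * Y * (2 * (G.distBall (5 * k) u).card) := by
      gcongr
    linarith
  have h1 := hG.dist_triangle (u := v) (v := u) (w := w)
  have h2 := main v
  have h3 := main w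
  rw [dist_comm] at h2
  omega

/-- Iterating the growth of balls: the diameter is at most `26 * 6 ^ J * k`, if `k (k - 1) n` is at
least `4 α` and `2 ^ 2 ^ J` exceeds the number of vertices. -/
theorem AddStable.dist_le {G : SimpleGraph V} {α : ℝ} (h : G.AddStable α) (hG : G.Connected)
    (hα : 0 < α) {k J : ℕ} (hk : 4 * α ≤ ((k - 1 : ℕ) * k * Fintype.card V : ℝ))
    (hJ : Fintype.card V < 2 ^ 2 ^ J) (v w : V) : G.dist v w ≤ 26 * 6 ^ J * k := by
  have hk1 : 1 ≤ k := by
    rcases Nat.eq_zero_or_pos k with rfl | hk0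
    · simp at hk
      linarith
    · exact hk0
  by_contra! hcon
  have hdiam : ∀ j ≤ J, 26 * (6 ^ j * k) < G.dist v w := by
    intro j hj
    refine lt_of_le_of_lt ?_ hcon
    rw [← mul_assoc]
    gcongr
    norm_num
  -- The distant pair v, w rules out the case of a large ball at every scale up to J.
  have hsmall : ∀ j ≤ J, ∀ Y : ℕ, (∀ x, Y ≤ (G.distBall (6 ^ j * k) x).card) →
      (2 * α * 2 ^ 2 ^ j : ℝ) ≤ (6 ^ j * k - 1 : ℕ) * Y * Fintype.card V →
      ∀ x, 2 * (G.distBall (5 * (6 ^ j * k)) x).card ≤ Fintype.card V := by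
    intro j hj Y hY hX x
    by_contra! hx
    have hlt : 2 * α < ((6 ^ j * k : ℕ) * Y * Fintype.card V : ℝ) := by
      have h2 : (2 : ℝ) ≤ 2 ^ 2 ^ j := by
        simpa using pow_le_pow_right₀ (one_le_two : (1 : ℝ) ≤ 2) (Nat.one_le_two_pow (n := j))
      have h3 : ((6 ^ j * k - 1 : ℕ) * Y * Fintype.card V : ℝ) ≤
          (6 ^ j * k : ℕ) * Y * Fintype.card V := by
        have : ((6 ^ j * k - 1 : ℕ) : ℝ) ≤ (6 ^ j * k : ℕ) := by exact_mod_cast Nat.sub_le _ _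
        gcongr
      nlinarith
    have h4 := h.dist_le_of_large_ball hG (Nat.one_le_iff_ne_zero.2 (by positivity)) hY hlt hx v w
    have h5 := hdiam j hj
    omega
  -- The invariant says X ≥ 2 ^ 2 ^ j at radius 6 ^ j * k. Since Y gets multiplied by 2 ^ 2 ^ j, the
  -- next bound is its square. The start Y = k comes from a geodesic.
  have key : ∀ j ≤ J, ∃ Y : ℕ, (∀ x, Y ≤ (G.distBall (6 ^ j * k) x).card) ∧
      (2 * α * 2 ^ 2 ^ j : ℝ) ≤ (6 ^ j * k - 1 : ℕ) * Y * Fintype.card V := by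
    intro j
    induction j with
    | zero =>
      intro _
      refine ⟨k, fun x => ?_, ?_⟩
      · simp only [pow_zero, one_mul]
        have h0 := hdiam 0 (Nat.zero_le _)
        have h1 := hG.dist_triangle (u := v) (v := x) (w := w)
        have h2 : G.dist v x = G.dist x v := dist_comm
        by_cases h3 : k ≤ G.dist x v
        · exact hG.le_card_distBall h3
        · exact hG.le_card_distBall (w := w) (by omega)
      · simp only [pow_zero, one_mul, pow_one]
        linarith
    | succ j ih =>
      intro hj
      obtain ⟨Y, hY, hX⟩ := ih (by omega)
      set K := 6 ^ j * k with hK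
      have hK1 : 1 ≤ K := Nat.one_le_iff_ne_zero.2 (by positivity)
      refine ⟨⌈(2 ^ 2 ^ j : ℝ)⌉₊ * Y, fun x => ?_, ?_⟩
      · obtain ⟨T, hT1, hT2⟩ := h.exists_separated_shell hG hK1 hY
          (hsmall j (by omega) Y hY hX x)
        have h1 : (2 ^ 2 ^ j : ℝ) ≤ T.card := by
          have : 2 * α * 2 ^ 2 ^ j ≤ 2 * α * T.card := hX.trans hT1
          exact le_of_mul_le_mul_left this (by positivity)
        have h2 : 6 ^ (j + 1) * k = 6 * K := by rw [hK]; ring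
        rw [h2]
        refine le_trans ?_ hT2
        gcongr
        exact Nat.ceil_le.2 h1
      · have h2 : 6 ^ (j + 1) * k = 6 * K := by rw [hK]; ring
        have h3 : ((K - 1 : ℕ) : ℝ) ≤ (6 ^ (j + 1) * k - 1 : ℕ) := by
          rw [h2]
          exact_mod_cast (by omega : K - 1 ≤ 6 * K - 1)
        have h4 : (2 ^ 2 ^ j : ℝ) ≤ ⌈(2 ^ 2 ^ j : ℝ)⌉₊ := Nat.le_ceil _
        push_cast
        calc (2 * α * 2 ^ 2 ^ (j + 1) : ℝ) = 2 ^ 2 ^ j * (2 * α * 2 ^ 2 ^ j) := by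
              rw [pow_succ 2 j, pow_mul]; ring
          _ ≤ 2 ^ 2 ^ j * ((K - 1 : ℕ) * Y * Fintype.card V) := by gcongr
          _ = (K - 1 : ℕ) * (2 ^ 2 ^ j * Y) * Fintype.card V := by ring
          _ ≤ _ := by gcongr
  obtain ⟨Y, hY, hX⟩ := key J le_rfl
  have hK1 : 1 ≤ 6 ^ J * k := Nat.one_le_iff_ne_zero.2 (by positivity)
  -- One more shell would have at least 2 ^ 2 ^ J points, more than there are vertices.
  obtain ⟨T, hT1, -⟩ := h.exists_separated_shell hG hK1 hY (hsmall J le_rfl Y hY hX v)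
  have h1 : (2 ^ 2 ^ J : ℝ) ≤ T.card := by
    have : 2 * α * 2 ^ 2 ^ J ≤ 2 * α * T.card := hX.trans hT1
    exact le_of_mul_le_mul_left this (by positivity)
  have h2 : 2 ^ 2 ^ J ≤ T.card := by exact_mod_cast h1
  have h3 := T.card_le_univ
  omega

/-! ### Edges with and without short detours -/

open Classical in
/-- The edges around which there is a detour of length at most `ℓ`. -/
def shortEdges (G : SimpleGraph V) (ℓ : ℕ) : Finset (Sym2 V) :=
  G.edgeFinset.filter fun e => ∃ a b, e = s(a, b) ∧ (G.deleteEdges {s(a, b)}).edist a b ≤ ℓ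

/-- Each edge with a short detour is used by many geodesics. -/
theorem DeleteStable.mul_card_shortEdges_le {G : SimpleGraph V} {α : ℝ} (h : G.DeleteStable α)
    (hG : G.Connected) (ℓ : ℕ) : α * (G.shortEdges ℓ).card ≤ ℓ * G.distSum := by
  classical
  have := hG.nonempty
  choose p hp using fun x y => hG.exists_walk_length_eq_dist x y
  have key : ∀ e ∈ G.shortEdges ℓ,
      α ≤ (ℓ * ∑ x : V, ∑ y : V, (p x y).edges.count e : ℕ) := by
    intro e he
    rw [shortEdges, Finset.mem_filter, mem_edgeFinset] at he
    obtain ⟨heG, a, b, rfl, hd⟩ := he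
    have hle := fun x y => edist_deleteEdges_le hd (p x y)
    have hconn : (G.deleteEdges {s(a, b)}).Connected :=
      connected_of_edist_ne_top fun x y => ((hle x y).trans_lt (ENat.natCast_lt_top _)).ne
    have h1 := h a b heG hconn
    have h2 : (G.deleteEdges {s(a, b)}).distSum ≤
        G.distSum + ℓ * ∑ x : V, ∑ y : V, (p x y).edges.count s(a, b) := by
      simp only [distSum, Finset.mul_sum, ← Finset.sum_add_distrib]
      refine Finset.sum_le_sum fun x _ => Finset.sum_le_sum fun y _ => ?_
      have h3 := hle x y
      rw [← (hconn x y).coe_dist_eq_edist, hp] at h3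
      exact_mod_cast h3
    have h3 : ((G.deleteEdges {s(a, b)}).distSum : ℝ) ≤
        G.distSum + (ℓ * ∑ x : V, ∑ y : V, (p x y).edges.count s(a, b) : ℕ) := by
      exact_mod_cast h2
    linarith
  -- Double counting: the multiplicities of the edges of a geodesic sum to its length.
  have hcount : ∑ e ∈ G.shortEdges ℓ, ∑ x : V, ∑ y : V, (p x y).edges.count e ≤ G.distSum := by
    rw [Finset.sum_comm, distSum]
    refine Finset.sum_le_sum fun x _ => ?_
    rw [Finset.sum_comm]
    refine Finset.sum_le_sum fun y _ => ?_
    rw [← hp x y, ← Walk.length_edges, ← List.sum_toFinset_count_eq_length]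
    refine Finset.sum_le_sum_of_ne_zero fun e _ he => ?_
    rw [List.mem_toFinset]
    exact List.count_pos_iff.1 (Nat.pos_of_ne_zero he)
  calc α * (G.shortEdges ℓ).card = ∑ e ∈ G.shortEdges ℓ, α := by
        rw [Finset.sum_const, nsmul_eq_mul, mul_comm]
    _ ≤ ∑ e ∈ G.shortEdges ℓ, ((ℓ * ∑ x : V, ∑ y : V, (p x y).edges.count e : ℕ) : ℝ) :=
        Finset.sum_le_sum key
    _ = (ℓ * ∑ e ∈ G.shortEdges ℓ, ∑ x : V, ∑ y : V, (p x y).edges.count e : ℕ) := by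
        rw [Finset.mul_sum]; push_cast; rfl
    _ ≤ (ℓ * G.distSum : ℕ) := by gcongr
    _ = ℓ * G.distSum := by push_cast; rfl

/-- If no edge has a detour of length at most `2 * L`, then the ball of radius `r ≤ L` spans a
tree. -/
theorem card_edges_ball_lt {H : SimpleGraph V} {L : ℕ}
    (hH : ∀ a b, H.Adj a b → (2 * L : ℕ) < (H.deleteEdges {s(a, b)}).edist a b)
    (u : V) {r : ℕ} (hr : r ≤ L) {F : Finset (Sym2 V)} {B : Finset V}
    (hF : ∀ e ∈ F, e ∈ H.edgeSet ∧ ∀ v ∈ e, H.edist u v ≤ r)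
    (hB : ∀ v, v ∈ B ↔ H.edist u v ≤ r) : F.card < B.card := by
  classical
  -- The parent of y: a neighbour closer to u. Edges of F are recovered from their farther end, and
  -- u is nobody's farther end. The default value is irrelevant.
  let g : V → V := fun y =>
    if h : ∃ z, H.Adj z y ∧ H.edist u z < H.edist u y then h.choose else y
  -- Equidistant ends, or two parents of one vertex (`huniq`), would give a detour of length at most
  -- 2r through u.
  have hlt : ∀ a b, H.Adj a b → H.edist u b ≤ r → H.edist u a ≤ H.edist u b →
      H.edist u a < H.edist u b := by
    intro a b hab hb hle
    refine lt_of_le_of_ne hle fun heq => ?_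
    have h1 := edist_deleteEdges_le_edist (x := a) hab.ne heq.le
    have h2 := edist_deleteEdges_le_edist (x := b) hab.ne.symm heq.ge
    rw [Sym2.eq_swap] at h2
    have h3 := hH a b hab
    have h4 := (H.deleteEdges {s(a, b)}).edist_triangle (u := a) (v := u) (w := b)
    rw [edist_comm (u := a) (v := u)] at h4
    have h5 := h3.trans_le (h4.trans (add_le_add (h1.trans (hle.trans hb)) (h2.trans hb)))
    norm_cast at h5
    omega
  have huniq : ∀ a a' b, H.Adj a b → H.Adj a' b → H.edist u b ≤ r → H.edist u a < H.edist u b →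
      H.edist u a' < H.edist u b → a = a' := by
    intro a a' b hab hab' hb ha ha'
    by_contra hne
    have h1 := edist_deleteEdges_le_edist (x := a) hab.ne ha.le
    have h2 := edist_deleteEdges_le_edist (x := a) hab'.ne ha'.le
    have h3 := hH a b hab
    have h4 := (H.deleteEdges {s(a, b)}).edist_triangle (u := a) (v := u) (w := b)
    have h5 := (H.deleteEdges {s(a, b)}).edist_triangle (u := u) (v := a') (w := b)
    have h6 : (H.deleteEdges {s(a, b)}).edist a' b = 1 := by
      rw [edist_eq_one_iff_adj, deleteEdges_adj]
      refine ⟨hab', fun h => ?_⟩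
      rcases Sym2.eq_iff.1 (Set.mem_singleton_iff.1 h) with ⟨h, -⟩ | ⟨-, h⟩
      · exact hne h.symm
      · exact hab.ne h.symm
    rw [edist_comm (u := a) (v := u)] at h4
    have h7 := Order.add_one_le_of_lt ha'
    have h8 : (H.deleteEdges {s(a, b)}).edist u b ≤ r := by
      rw [h6] at h5
      exact h5.trans ((add_le_add_left h2 1).trans (h7.trans hb))
    have h9 := h3.trans_le (h4.trans (add_le_add (h1.trans (ha.le.trans hb)) h8))
    norm_cast at h9
    omega
  have hg : ∀ a b, H.Adj a b → H.edist u b ≤ r → H.edist u a < H.edist u b → g b = a := by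
    intro a b hab hb ha
    have hex : ∃ z, H.Adj z b ∧ H.edist u z < H.edist u b := ⟨a, hab, ha⟩
    have hgb : g b = hex.choose := dif_pos hex
    rw [hgb]
    exact huniq _ _ _ hex.choose_spec.1 hab hb hex.choose_spec.2 ha
  have hu : u ∈ B := by simp [hB]
  have hsub : F ⊆ (B.erase u).image fun y => s(g y, y) := by
    have aux : ∀ a b, H.Adj a b → H.edist u b ≤ r → H.edist u a ≤ H.edist u b →
        s(a, b) ∈ (B.erase u).image fun y => s(g y, y) := by
      intro a b hab hb hle
      have hl := hlt a b hab hb hle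
      refine Finset.mem_image.2 ⟨b, Finset.mem_erase.2 ⟨?_, (hB b).2 hb⟩, ?_⟩
      · rintro rfl
        simp at hl
      · rw [hg a b hab hb hl]
    intro e he
    obtain ⟨he1, he2⟩ := hF e he
    induction e with
    | _ a b =>
      rcases le_total (H.edist u a) (H.edist u b) with hle | hle
      · exact aux a b he1 (he2 b (by simp)) hle
      · rw [Sym2.eq_swap]
        exact aux b a (show H.Adj b a from (show H.Adj a b from he1).symm) (he2 a (by simp)) hle
  exact ((Finset.card_le_card hsub).trans Finset.card_image_le).trans_lt
    (Finset.card_erase_lt_of_mem hu)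

open Classical in
/-- A graph in which no edge has a detour of length at most `2 * L`, with `2 ^ L` larger than the
number of vertices, has at most twice as many edges as (non-isolated) vertices. -/
theorem card_edgeFinset_le_two_mul {L : ℕ} (hL : Fintype.card V < 2 ^ L) (m : ℕ) :
    ∀ (H : SimpleGraph V) (W : Finset V), W.card = m → (∀ a b, H.Adj a b → a ∈ W) →
      (∀ a b, H.Adj a b → (2 * L : ℕ) < (H.deleteEdges {s(a, b)}).edist a b) →
      H.edgeFinset.card ≤ 2 * m := by
  induction m using Nat.strong_induction_on with
  | _ m ih =>
  intro H W hWm hW hH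
  rcases W.eq_empty_or_nonempty with rfl | ⟨u, hu⟩
  · have : H.edgeFinset = ∅ := by
      refine Finset.eq_empty_of_forall_notMem fun e he => ?_
      rw [mem_edgeFinset] at he
      induction e with
      | _ a b => simpa using hW a b he
    simp [this]
  set B : ℕ → Finset V := fun r => Finset.univ.filter fun v => H.edist u v ≤ r with hB
  have hBmem : ∀ r v, v ∈ B r ↔ H.edist u v ≤ r := fun r v => by simp [hB]
  -- If the balls more than doubled L times, the last one would have at least 2 ^ L vertices.
  obtain ⟨r, hrL, hr⟩ : ∃ r < L, (B (r + 1)).card ≤ 2 * (B r).card := by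
    by_contra! hcon
    have hpow : ∀ r ≤ L, 2 ^ r ≤ (B r).card := by
      intro r
      induction r with
      | zero =>
        intro _
        exact Finset.card_pos.2 ⟨u, by simp [hBmem]⟩
      | succ r ihr =>
        intro hr
        have h1 := hcon r (by omega)
        have h2 := ihr (by omega)
        rw [pow_succ]
        omega
    have h1 := hpow L le_rfl
    have h2 := (B L).card_le_univ
    omega
  have hBW : B r ⊆ W := by
    have hwalk : ∀ {x y : V}, H.Walk x y → x ∈ W → y ∈ W := by
      intro x y p
      induction p with
      | nil => exact id
      | cons h p ihp => exact fun _ => ihp (hW _ _ h.symm)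
    intro v hv
    rw [hBmem] at hv
    obtain ⟨p⟩ := edist_ne_top_iff_reachable.1 (hv.trans_lt (ENat.natCast_lt_top r)).ne
    exact hwalk p hu
  have hBpos : 0 < (B r).card := Finset.card_pos.2 ⟨u, by simp [hBmem]⟩
  -- The edges meeting B r lie inside B (r + 1), so there are fewer than |B (r + 1)| ≤ 2|B r| of
  -- them. The other edges live on W \ B r, and detours only get longer under deletion.
  set H' := H.deleteEdges {e | ∃ v ∈ e, v ∈ B r} with hH'
  have hle : H' ≤ H := deleteEdges_le _
  have h1 : H'.edgeFinset.card ≤ 2 * (W \ B r).card := by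
    convert ih _ ?_ H' (W \ B r) rfl ?_ ?_
    · rw [← hWm, Finset.card_sdiff_of_subset hBW]
      have := Finset.card_le_card hBW
      omega
    · intro a b hab
      rw [hH', deleteEdges_adj] at hab
      refine Finset.mem_sdiff.2 ⟨hW a b hab.1, fun ha => hab.2 ⟨a, by simp, ha⟩⟩
    · intro a b hab
      exact (hH a b (hle hab)).trans_le (edist_anti (deleteEdges_mono hle))
  set F : Finset (Sym2 V) := H.edgeFinset.filter fun e => ∃ v ∈ e, v ∈ B r with hF
  have h2 : F.card < (B (r + 1)).card := by
    refine card_edges_ball_lt hH u hrL ?_ (hBmem (r + 1))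
    intro e he
    rw [hF, Finset.mem_filter, mem_edgeFinset] at he
    obtain ⟨he, v, hv, hvB⟩ := he
    refine ⟨he, fun w hw => ?_⟩
    rw [hBmem] at hvB
    have h3 : H.edist v w ≤ 1 := by
      rw [edist_le_one_iff_adj_or_eq]
      by_cases hvw : v = w
      · exact Or.inr hvw
      · have := (Sym2.mem_and_mem_iff hvw).1 ⟨hv, hw⟩
        rw [this] at he
        exact Or.inl he
    have h4 := (H.edist_triangle (u := u) (v := v) (w := w)).trans (add_le_add hvB h3)
    exact_mod_cast h4
  have h3 : H.edgeFinset ⊆ F ∪ H'.edgeFinset := by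
    intro e he
    rw [Finset.mem_union, mem_edgeFinset, hH', edgeSet_deleteEdges, hF, Finset.mem_filter]
    by_cases hex : ∃ v ∈ e, v ∈ B r
    · exact Or.inl ⟨he, hex⟩
    · exact Or.inr ⟨mem_edgeFinset.1 he, hex⟩
  have h4 := (Finset.card_le_card h3).trans (Finset.card_union_le _ _)
  rw [Finset.card_sdiff_of_subset hBW] at h1
  have h5 := Finset.card_le_card hBW
  omega

open Classical in
/-- All but `2 n` edges have detours of logarithmic length. -/
theorem card_edgeFinset_le_card_shortEdges {L : ℕ} (hL : Fintype.card V < 2 ^ L)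
    (G : SimpleGraph V) :
    G.edgeSet.ncard ≤ 2 * Fintype.card V + (G.shortEdges (2 * L)).card := by
  set H := G.deleteEdges (G.shortEdges (2 * L)) with hH
  have h1 : H.edgeFinset.card ≤ 2 * Fintype.card V := by
    convert card_edgeFinset_le_two_mul hL (Fintype.card V) H Finset.univ Finset.card_univ (fun _ _ _ => Finset.mem_univ _) ?_
    intro a b hab
    rw [hH, deleteEdges_adj] at hab
    have h2 : (2 * L : ℕ) < (G.deleteEdges {s(a, b)}).edist a b := by
      by_contra! hcon
      exact hab.2 (Finset.mem_coe.2 (Finset.mem_filter.2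
        ⟨mem_edgeFinset.2 hab.1, a, b, rfl, hcon⟩))
    exact h2.trans_le (edist_anti (deleteEdges_mono (deleteEdges_le _)))
  have h2 : G.edgeFinset ⊆ H.edgeFinset ∪ G.shortEdges (2 * L) := by
    intro e he
    rw [Finset.mem_union, mem_edgeFinset, hH, edgeSet_deleteEdges]
    by_cases hs : e ∈ G.shortEdges (2 * L)
    · exact Or.inr hs
    · exact Or.inl ⟨mem_edgeFinset.1 he, hs⟩
  rw [← coe_edgeFinset, Set.ncard_coe_finset]
  exact (Finset.card_le_card h2).trans ((Finset.card_union_le _ _).trans (by omega))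

/-! ### Quantitative bounds for stable graphs -/

/-- In a stable graph the distances are `O(α / (n lg n))`, provided that
`α ≥ c n (lg n) ^ (2 + 2 lg 6)`. -/
theorem AddStable.logb_mul_dist_le {G : SimpleGraph V} {α c : ℝ} (h : G.AddStable α)
    (hG : G.Connected) (hc : 0 < c) (hn : 2 ≤ Fintype.card V)
    (hα : c * ((Fintype.card V : ℝ) *
      Real.logb 2 (Fintype.card V : ℝ) ^ (2 + 2 * Real.logb 2 6)) ≤ α) (v w : V) :
    Real.logb 2 (Fintype.card V : ℝ) * G.dist v w ≤
      936 * (2 + 2 / √c) / √c * (α / Fintype.card V) := by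
  set n := Fintype.card V with hn'
  set lg := Real.logb 2 (n : ℝ) with hlg
  set q := Real.logb 2 6 with hq
  have hn2 : (2 : ℝ) ≤ n := by exact_mod_cast hn
  have hn0 : (0 : ℝ) < n := by linarith
  have hlg1 : 1 ≤ lg := by
    rw [hlg, Real.le_logb_iff_rpow_le one_lt_two hn0]
    simpa using hn2
  have hlg0 : 0 < lg := by linarith
  have hq0 : 0 ≤ q := Real.logb_nonneg one_lt_two (by norm_num)
  have hα0 : 0 < α := lt_of_lt_of_le (by positivity) hα
  set r := √(α / n) with hr
  have hr2 : r * r = α / n := Real.mul_self_sqrt (by positivity)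
  have hsc : 0 < √c := Real.sqrt_pos.2 hc
  -- This is where the exponent 2 + 2 lg 6 = 2(1 + q) comes from: one factor lg is needed for the
  -- detour length, and lg ^ q for the 6 ^ J of the diameter bound.
  have hrlg : √c * lg ^ (1 + q) ≤ r := by
    refine Real.le_sqrt_of_sq_le ?_
    rw [mul_pow, Real.sq_sqrt hc.le, le_div_iff₀ hn0, ← Real.rpow_natCast, ← Real.rpow_mul hlg0.le]
    have : (1 + q) * (2 : ℕ) = 2 + 2 * q := by push_cast; ring
    rw [this]
    linarith
  have hrc : √c ≤ r := by
    refine le_trans ?_ hrlg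
    have := Real.one_le_rpow hlg1 (by linarith : 0 ≤ 1 + q)
    nlinarith
  have hr0 : 0 < r := hsc.trans_le hrc
  -- Both k - 1 and k are at least 2√(α/n), as `dist_le` requires.
  set k := ⌈2 * r⌉₊ + 1 with hk
  have hk1 : 4 * α ≤ ((k - 1 : ℕ) * k * n : ℝ) := by
    have h1 : 2 * r ≤ (k - 1 : ℕ) := Nat.le_ceil _
    have h2 : 2 * r ≤ k := (Nat.le_ceil _).trans (by rw [hk]; push_cast; linarith)
    have h3 : 4 * α = 2 * r * (2 * r) * n := by
      have : r * r * n = α := by rw [hr2]; field_simp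
      linarith
    rw [h3]
    gcongr
  have hk2 : (k : ℝ) ≤ (2 + 2 / √c) * r := by
    have h1 := Nat.ceil_lt_add_one (by positivity : 0 ≤ 2 * r)
    have h2 : 1 ≤ r / √c := (one_le_div hsc).2 hrc
    have h3 : (2 + 2 / √c) * r = 2 * r + 2 * (r / √c) := by ring
    rw [h3, hk]
    push_cast
    linarith
  set m := Nat.log 2 n + 1 with hm
  have hm1 : n < 2 ^ m := Nat.lt_pow_succ_log_self one_lt_two n
  have hm2 : (m : ℝ) ≤ 2 * lg := by
    have : (Nat.log 2 n : ℝ) ≤ lg := by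
      rw [hlg, Real.le_logb_iff_rpow_le one_lt_two hn0, Real.rpow_natCast]
      exact_mod_cast Nat.pow_log_le_self 2 (by omega)
    rw [hm]
    push_cast
    linarith
  have hm3 : 1 < m := by
    have := Nat.log_pos one_lt_two hn
    omega
  set J := Nat.clog 2 m with hJ
  have hJ1 : n < 2 ^ 2 ^ J := hm1.trans_le (Nat.pow_le_pow_right two_pos
    (Nat.le_pow_clog one_lt_two m))
  have hJ2 : (2 ^ J : ℝ) ≤ 4 * lg := by
    have h1 : 2 ^ (J - 1) < m := Nat.pow_pred_clog_lt_self one_lt_two hm3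
    have h2 : 0 < J := Nat.clog_pos one_lt_two hm3
    have h3 : 2 ^ J = 2 * 2 ^ (J - 1) := by rw [← pow_succ', Nat.sub_add_cancel h2]
    have h4 : (2 ^ J : ℝ) ≤ 2 * m := by
      have : 2 ^ J ≤ 2 * m := by omega
      exact_mod_cast this
    linarith
  have h2q : (2 : ℝ) ^ q = 6 := Real.rpow_logb two_pos (by norm_num) (by norm_num)
  have h6J : (6 ^ J : ℝ) ≤ 36 * lg ^ q := by
    have h1 : (6 ^ J : ℝ) = (2 ^ J : ℝ) ^ q := by
      rw [← h2q, ← Real.rpow_natCast, ← Real.rpow_natCast, ← Real.rpow_mul zero_le_two,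
        ← Real.rpow_mul zero_le_two, mul_comm]
    have h4 : (4 : ℝ) ^ q = 36 := by
      rw [show (4 : ℝ) = 2 * 2 by norm_num, Real.mul_rpow zero_le_two zero_le_two, h2q]
      norm_num
    rw [h1, ← h4, ← Real.mul_rpow (by norm_num) hlg0.le]
    exact Real.rpow_le_rpow (by positivity) hJ2 hq0
  have hd : (G.dist v w : ℝ) ≤ 26 * 6 ^ J * k := by
    exact_mod_cast h.dist_le hG hα0 hk1 hJ1 v w
  calc lg * G.dist v w ≤ lg * (26 * (36 * lg ^ q) * ((2 + 2 / √c) * r)) := by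
        have : (26 * 6 ^ J * k : ℝ) ≤ 26 * (36 * lg ^ q) * ((2 + 2 / √c) * r) := by gcongr
        have := hd.trans this
        gcongr
    _ = 936 * (2 + 2 / √c) / √c * ((√c * lg ^ (1 + q)) * r) := by
        rw [Real.rpow_add hlg0, Real.rpow_one]
        field_simp
        ring
    _ ≤ 936 * (2 + 2 / √c) / √c * (r * r) := by gcongr
    _ = _ := by rw [hr2]

/-- The social cost of a stable graph is `O(α n)`. -/
theorem cost_le_of_stable {G : SimpleGraph V} {α c : ℝ} (hadd : G.AddStable α)
    (hdel : G.DeleteStable α) (hG : G.Connected) (hc : 0 < c) (hn : 2 ≤ Fintype.card V)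
    (hα : c * ((Fintype.card V : ℝ) *
      Real.logb 2 (Fintype.card V : ℝ) ^ (2 + 2 * Real.logb 2 6)) ≤ α) :
    α * G.edgeSet.ncard + G.distSum ≤
      (2 + 5 * (936 * (2 + 2 / √c) / √c)) * (α * Fintype.card V) := by
  have hd := hadd.logb_mul_dist_le hG hc hn hα
  set n := Fintype.card V with hn'
  set lg := Real.logb 2 (n : ℝ) with hlg
  set A := 936 * (2 + 2 / √c) / √c with hA
  have hn2 : (2 : ℝ) ≤ n := by exact_mod_cast hn
  have hn0 : (0 : ℝ) < n := by linarith
  have hlg1 : 1 ≤ lg := by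
    rw [hlg, Real.le_logb_iff_rpow_le one_lt_two hn0]
    simpa using hn2
  have hlg0 : 0 < lg := by linarith
  have hα0 : 0 < α := lt_of_lt_of_le (by positivity) hα
  have hD : lg * G.distSum ≤ A * (α * n) := by
    have h1 : lg * G.distSum = ∑ v : V, ∑ w : V, lg * G.dist v w := by
      simp only [distSum, ← Finset.mul_sum]
      push_cast
      rfl
    rw [h1]
    calc ∑ v : V, ∑ w : V, lg * G.dist v w ≤ ∑ v : V, ∑ w : V, A * (α / n) :=
          Finset.sum_le_sum fun v _ => Finset.sum_le_sum fun w _ => hd v w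
      _ = A * (α * n) := by
          simp only [Finset.sum_const, Finset.card_univ, nsmul_eq_mul, ← hn']
          field_simp
  have hD1 : (G.distSum : ℝ) ≤ A * (α * n) := by
    refine le_trans ?_ hD
    have : (0 : ℝ) ≤ G.distSum := by positivity
    nlinarith
  set m := Nat.log 2 n + 1 with hm
  have hm1 : n < 2 ^ m := Nat.lt_pow_succ_log_self one_lt_two n
  have hm2 : (m : ℝ) ≤ 2 * lg := by
    have : (Nat.log 2 n : ℝ) ≤ lg := by
      rw [hlg, Real.le_logb_iff_rpow_le one_lt_two hn0, Real.rpow_natCast]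
      exact_mod_cast Nat.pow_log_le_self 2 (by omega)
    rw [hm]
    push_cast
    linarith
  have hE : (G.edgeSet.ncard : ℝ) ≤ 2 * n + (G.shortEdges (2 * m)).card := by
    exact_mod_cast card_edgeFinset_le_card_shortEdges hm1 G
  have hS := hdel.mul_card_shortEdges_le hG (2 * m)
  have hS' : α * (G.shortEdges (2 * m)).card ≤ 4 * A * (α * n) := by
    refine hS.trans ?_
    push_cast
    calc 2 * (m : ℝ) * G.distSum ≤ 2 * (2 * lg) * G.distSum := by gcongr
      _ = 4 * (lg * G.distSum) := by ring
      _ ≤ 4 * (A * (α * n)) := by gcongr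
      _ = _ := by ring
  -- The factor 5 is 4 for the edges with short detours plus 1 for the distances themselves.
  have hE' : α * G.edgeSet.ncard ≤ α * (2 * n + (G.shortEdges (2 * m)).card) := by gcongr
  linarith

end SimpleGraph

/-! ### From equilibria to stable graphs -/

namespace NetworkCreation

open SimpleGraph

variable {V : Type*} [Fintype V] {H : SimpleGraph V} {α : ℝ≥0} {s s' : JointStrategy H}

theorem createdGraph_adj {x y : V} : (createdGraph α s).Adj x y ↔
    ∃ h : s(x, y) ∈ H.edgeSet, α ≤ totalBid s ⟨s(x, y), h⟩ := by
  rw [createdGraph, fromEdgeSet_adj, createdEdges, Set.mem_ofPred_eq]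
  exact ⟨fun h => h.1, fun h => ⟨h, H.ne_of_adj h.1⟩⟩

theorem edgeSet_createdGraph : (createdGraph α s).edgeSet = createdEdges α s := by
  ext e
  induction e with
  | _ x y => exact createdGraph_adj

theorem usageCost_eq (hs : (createdGraph α s).Connected) (i : V) :
    usageCost α s i = ((∑ j : V, (createdGraph α s).dist i j : ℕ) : ℝ≥0∞) := by
  rw [usageCost, Nat.cast_sum]
  refine Finset.sum_congr rfl fun j _ => ?_
  rw [← (hs i j).coe_dist_eq_edist]
  simp

theorem totalCost_eq (hs : (createdGraph α s).Connected) :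
    totalCost α s = α * ((createdGraph α s).edgeSet.ncard : ℝ≥0∞) +
      ((createdGraph α s).distSum : ℝ≥0∞) := by
  rw [totalCost, edgeSet_createdGraph, distSum, Nat.cast_sum]
  simp_rw [usageCost_eq hs]

theorem connected_of_totalCost_ne_top [Nonempty V] (hs : totalCost α s ≠ ⊤) :
    (createdGraph α s).Connected := by
  refine connected_of_edist_ne_top fun i j hij => hs ?_
  have h1 : usageCost α s i = ⊤ :=
    ENNReal.sum_eq_top.2 ⟨j, Finset.mem_univ _, by rw [hij]; rfl⟩
  rw [totalCost, ENNReal.sum_eq_top.2 ⟨i, Finset.mem_univ _, h1⟩]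
  simp

theorem IsDeviation.totalBid_eq {e f : H.edgeSet} {C : Finset V} (h : IsDeviation s s' e C)
    (hf : f ≠ e) : totalBid s' f = totalBid s f :=
  Finset.sum_congr rfl fun i _ => h i f fun h => hf h.2

theorem IsDeviation.payment_eq {e f : H.edgeSet} {C : Finset V} (h : IsDeviation s s' e C)
    (hf : f ≠ e) (i : V) : payment α s' i f = payment α s i f := by
  rw [payment, payment, h.totalBid_eq hf, h i f fun h => hf h.2]

/-- Isolates the one edge on which a deviation acts. Writing the cost as a coerced finite number
allows the payments for the other edges to be cancelled. -/
theorem playerCost_eq (hs : (createdGraph α s).Connected) (i : V) (e : H.edgeSet)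
    [Fintype H.edgeSet] [DecidableEq H.edgeSet] :
    playerCost α s i = ((∑ f ∈ Finset.univ.erase e, payment α s i f + (payment α s i e +
      (∑ j : V, (createdGraph α s).dist i j : ℕ)) : ℝ≥0) : ℝ≥0∞) := by
  rw [playerCost, usageCost_eq hs]
  push_cast
  rw [← add_assoc]
  congr 1
  rw [Finset.sum_erase_add _ _ (Finset.mem_univ e)]
  exact Finset.sum_congr (by ext; simp) fun _ _ => rfl

/-- Two strategies that differ only on the edge `e` are compared by the payments for `e` and the
distances. -/
theorem IsDeviation.payment_add_le {e : H.edgeSet} {C : Finset V} (h : IsDeviation s s' e C)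
    (hs : (createdGraph α s).Connected) (hs' : (createdGraph α s').Connected) {i : V}
    (hi : playerCost α s i ≤ playerCost α s' i) :
    (payment α s i e : ℝ) + (∑ j : V, (createdGraph α s).dist i j : ℕ) ≤
      payment α s' i e + (∑ j : V, (createdGraph α s').dist i j : ℕ) := by
  classical
  rw [playerCost_eq hs i e, playerCost_eq hs' i e, ENNReal.coe_le_coe,
    Finset.sum_congr rfl fun f hf => h.payment_eq (Finset.ne_of_mem_erase hf) i,
    add_le_add_iff_left] at hi
  exact_mod_cast hi

theorem IsDeviation.createdGraph_adj_iff {e : H.edgeSet} {C : Finset V}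
    (h : IsDeviation s s' e C) {x y : V} (hxy : s(x, y) ≠ e) :
    (createdGraph α s').Adj x y ↔ (createdGraph α s).Adj x y := by
  rw [createdGraph_adj, createdGraph_adj]
  refine exists_congr fun hH => ?_
  rw [h.totalBid_eq fun h => hxy (congrArg Subtype.val h)]

/-- The members of a coalition that offer in proportion to their gains make a new edge
profitable as soon as the total gain exceeds `α`. -/
theorem IsCollaborativeEquilibrium.addStable {s : JointStrategy (⊤ : SimpleGraph V)}
    (hs : IsCollaborativeEquilibrium α s) (hG : (createdGraph α s).Connected) :
    (createdGraph α s).AddStable α := by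
  classical
  intro a b hab hadj
  by_contra! hlt
  set G := createdGraph α s with hGdef
  set G' := G ⊔ edge a b with hG'
  have hle : G ≤ G' := le_sup_left
  have hconn : G'.Connected := hG.mono hle
  set u : V → ℕ := fun i => ∑ j : V, G.dist i j with hu
  set u' : V → ℕ := fun i => ∑ j : V, G'.dist i j with hu'
  have huu : ∀ i, u' i ≤ u i := fun i => Finset.sum_le_sum fun j _ => (hG i j).dist_anti hle
  set g : V → ℕ := fun i => u i - u' i with hg
  have hgsum : ∑ i, g i + G'.distSum = G.distSum := by
    rw [distSum, distSum, ← Finset.sum_add_distrib]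
    exact Finset.sum_congr rfl fun i _ => Nat.sub_add_cancel (huu i)
  set Γ : ℝ≥0 := ((∑ i, g i : ℕ) : ℝ≥0) with hΓ
  have hαΓ : α < Γ := by
    have : (G.distSum : ℝ) = Γ + G'.distSum := by
      rw [← hgsum, hΓ]
      push_cast
      rfl
    have : (α : ℝ) < Γ := by linarith
    exact_mod_cast this
  have hΓ0 : 0 < Γ := pos_of_gt hαΓ
  set e : (⊤ : SimpleGraph V).edgeSet := ⟨s(a, b), hab⟩ with he
  -- Players without a gain must stay out of the coalition, as they could not profit strictly.
  set C : Finset V := Finset.univ.filter fun i => 0 < g i with hC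
  set s' : JointStrategy (⊤ : SimpleGraph V) := fun i f =>
    if i ∈ C ∧ f = e then α * g i / Γ else s i f with hs'
  have hdev : IsDeviation s s' e C := fun i f hif => if_neg hif
  have hbid : α ≤ totalBid s' e := by
    calc α = ∑ i, α * g i / Γ := by
          rw [← Finset.sum_div, ← Finset.mul_sum, ← Nat.cast_sum, ← hΓ,
            mul_div_cancel_right₀ _ hΓ0.ne']
      -- Outsiders may have offers standing on the unbuilt edge. The total can then exceed α, but
      -- rescaling only lowers what the members pay.
      _ ≤ ∑ i, s' i e := by
          refine Finset.sum_le_sum fun i _ => ?_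
          by_cases hi : i ∈ C
          · simp [hs', hi]
          · have : g i = 0 := by simpa [hC] using hi
            simp [this]
  have hgraph : createdGraph α s' = G' := by
    ext x y
    rw [hG', sup_adj, edge_adj]
    by_cases hxy : s(x, y) = s(a, b)
    · have hxy' := Sym2.eq_iff.1 hxy
      have hne : x ≠ y := by
        rcases hxy' with ⟨rfl, rfl⟩ | ⟨rfl, rfl⟩
        exacts [hab, hab.symm]
      have h1 : (createdGraph α s').Adj x y := by
        rw [createdGraph_adj]
        refine ⟨hne, ?_⟩
        convert hbid
        exact Subtype.ext hxy
      exact iff_of_true h1 (Or.inr ⟨hxy', hne⟩)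
    · rw [hdev.createdGraph_adj_iff hxy]
      have := mt Sym2.eq_iff.2 hxy
      tauto
  have hCne : C.Nonempty := by
    by_contra hemp
    have hzero : ∀ i, g i = 0 := fun i => by
      by_contra hi
      exact hemp ⟨i, by simpa [hC] using Nat.pos_of_ne_zero hi⟩
    simp [hΓ, hzero] at hΓ0
  obtain ⟨i, hiC, hi⟩ := hs e C hCne s' hdev
  have hgi : 0 < g i := by simpa [hC] using hiC
  have h1 := hdev.payment_add_le hG (hgraph ▸ hconn) hi
  rw [hgraph] at h1
  have h2 : payment α s i e = 0 := by
    rw [payment, if_neg]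
    exact fun hle => hadj (createdGraph_adj.2 ⟨hab, hle⟩)
  have h3 : payment α s' i e < g i := by
    have h4 : s' i e = α * g i / Γ := if_pos ⟨hiC, rfl⟩
    have h5 : s' i e < g i := by
      rw [h4, div_lt_iff₀ hΓ0, mul_comm]
      exact mul_lt_mul_of_pos_left hαΓ (by exact_mod_cast hgi)
    refine lt_of_le_of_lt ?_ h5
    rw [payment, if_pos hbid]
    refine NNReal.div_le_of_le_mul ?_
    rw [mul_comm]
    gcongr
  have h4 : (payment α s' i e : ℝ) < g i := by exact_mod_cast h3
  have h5 : ((g i : ℕ) : ℝ) + u' i = u i := by exact_mod_cast Nat.sub_add_cancel (huu i)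
  rw [h2] at h1
  simp only [NNReal.coe_zero, zero_add] at h1
  change ((u i : ℕ) : ℝ) ≤ payment α s' i e + (u' i : ℕ) at h1
  linarith

/-- If deleting an edge raises the sum of distances by less than `α`, some player pays more for the
edge than what its deletion costs them. -/
theorem IsCollaborativeEquilibrium.deleteStable (hs : IsCollaborativeEquilibrium α s)
    (hα : 0 < α) (hG : (createdGraph α s).Connected) :
    (createdGraph α s).DeleteStable α := by
  classical
  intro a b hadj hconn
  by_contra! hlt
  set G := createdGraph α s with hGdef
  set G' := G.deleteEdges {s(a, b)} with hG'
  set u : V → ℕ := fun i => ∑ j : V, G.dist i j with hu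
  set u' : V → ℕ := fun i => ∑ j : V, G'.dist i j with hu'
  have huu : ∀ i, u i ≤ u' i := fun i =>
    Finset.sum_le_sum fun j _ => (hconn i j).dist_anti (deleteEdges_le _)
  obtain ⟨habH, hbid⟩ := createdGraph_adj.1 hadj
  set e : H.edgeSet := ⟨s(a, b), habH⟩ with he
  have hpay : ∑ i, payment α s i e = α := by
    have h1 : ∀ i, payment α s i e = α * s i e / totalBid s e := fun i => if_pos hbid
    simp_rw [h1]
    rw [← Finset.sum_div, ← Finset.mul_sum]
    exact mul_div_cancel_right₀ _ (hα.trans_le hbid).ne'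
  -- Averaging: the payments for the edge sum to exactly α, more than the total loss from its
  -- deletion.
  obtain ⟨i, hi⟩ : ∃ i, (u' i : ℝ) < u i + payment α s i e := by
    by_contra! hcon
    have h1 := Finset.sum_le_sum fun i (_ : i ∈ Finset.univ) => hcon i
    rw [Finset.sum_add_distrib] at h1
    have h2 : ∑ i, (payment α s i e : ℝ) = α := by exact_mod_cast hpay
    have h3 : ∑ i, (u i : ℝ) = G.distSum := by rw [distSum, Nat.cast_sum]
    have h4 : ∑ i, (u' i : ℝ) = G'.distSum := by rw [distSum, Nat.cast_sum]
    rw [h2, h3, h4] at h1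
    linarith
  set s' : JointStrategy H := fun j f => if j ∈ ({i} : Finset V) ∧ f = e then 0 else s j f with hs'
  have hdev : IsDeviation s s' e {i} := fun j f hjf => if_neg hjf
  obtain ⟨j, hj, hcost⟩ := hs e {i} (Finset.singleton_nonempty i) s' hdev
  obtain rfl := Finset.mem_singleton.1 hj
  have hs0 : s' j e = 0 := if_pos ⟨hj, rfl⟩
  have hpay' : payment α s' j e = 0 := by simp [payment, hs0]
  have huj : (u j : ℝ) ≤ u' j := by exact_mod_cast huu j
  -- Without the offer of this player the others may still cover α. Then the link survives and the
  -- player saves a positive payment; otherwise the link disappears.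
  by_cases hbid' : α ≤ totalBid s' e
  · have hgraph : createdGraph α s' = G := by
      ext x y
      by_cases hxy : s(x, y) = s(a, b)
      · have h1 : G.Adj x y := by
          rw [← mem_edgeSet, hxy]
          exact hadj
        have h2 : (createdGraph α s').Adj x y := by
          rw [← mem_edgeSet, hxy]
          exact createdGraph_adj.2 ⟨habH, hbid'⟩
        exact iff_of_true h2 h1
      · exact hdev.createdGraph_adj_iff hxy
    have h1 := hdev.payment_add_le hG (hgraph ▸ hG) hcost
    rw [hgraph, hpay'] at h1
    change (payment α s j e : ℝ) + (u j : ℕ) ≤ (0 : ℝ≥0) + (u j : ℕ) at h1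
    simp only [NNReal.coe_zero] at h1
    linarith
  · have hgraph : createdGraph α s' = G' := by
      ext x y
      rw [hG', deleteEdges_adj, Set.mem_singleton_iff]
      by_cases hxy : s(x, y) = s(a, b)
      · refine iff_of_false (fun h => ?_) fun h => h.2 hxy
        rw [← mem_edgeSet, hxy] at h
        exact hbid' (createdGraph_adj.1 h).2
      · rw [hdev.createdGraph_adj_iff hxy]
        exact (and_iff_left hxy).symm
    have h1 := hdev.payment_add_le hG (hgraph ▸ hconn) hcost
    rw [hgraph, hpay'] at h1
    change (payment α s j e : ℝ) + (u j : ℕ) ≤ (0 : ℝ≥0) + (u' j : ℕ) at h1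
    simp only [NNReal.coe_zero] at h1
    linarith

/-- Every network of finite cost has at least `n - 1` links. -/
theorem le_two_mul_socialOptimum (hn : 2 ≤ Fintype.card V) :
    (α * Fintype.card V : ℝ≥0∞) ≤ 2 * socialOptimum H α := by
  have : Nonempty V := Fintype.card_pos_iff.1 (by omega)
  have h : (α * Fintype.card V : ℝ≥0∞) / 2 ≤ socialOptimum H α := by
    refine le_iInf fun s => ?_
    by_cases hs : totalCost α s = ⊤
    · simp [hs]
    have hconn := connected_of_totalCost_ne_top hs
    refine ENNReal.div_le_of_le_mul ?_
    rw [totalCost_eq hconn, add_mul, mul_assoc]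
    refine le_trans ?_ le_self_add
    have h1 := hconn.card_vert_le_card_edgeSet_add_one
    rw [Nat.card_eq_fintype_card, Nat.card_coe_set_eq] at h1
    -- For n ≥ 2, n ≤ 2(n - 1).
    have h2 : Fintype.card V ≤ (createdGraph α s).edgeSet.ncard * 2 := by omega
    gcongr
    exact_mod_cast h2
  rw [mul_comm (2 : ℝ≥0∞)]
  exact (ENNReal.div_le_iff two_ne_zero ENNReal.ofNat_ne_top).1 h

end NetworkCreation

end

/-! ### The price of anarchy -/

theorem mainTheorem3 (c : ℝ) (hc : 0 < c) :
    ∃ K : ℝ≥0, ∀ n : ℕ, 2 ≤ n → ∀ α : ℝ≥0,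
      c * ((n : ℝ) * Real.logb 2 (n : ℝ) ^ (2 + 2 * Real.logb 2 6)) ≤ (α : ℝ) →
        NetworkCreation.priceOfAnarchy (⊤ : SimpleGraph (Fin n)) α ≤ (K : ℝ≥0∞) := by
  set A : ℝ≥0 := Real.toNNReal (2 + 5 * (936 * (2 + 2 / √c) / √c)) with hA
  -- A bounds the equilibrium cost in units of αn, and αn is at most twice the optimum.
  refine ⟨A * 2, fun n hn α hα => ENNReal.div_le_of_le_mul ?_⟩
  have hcard : 2 ≤ Fintype.card (Fin n) := by simpa using hn
  have hα0 : 0 < α := by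
    have hn2 : (1 : ℝ) < n := by exact_mod_cast hn
    have := Real.logb_pos one_lt_two hn2
    have h1 : (0 : ℝ) < α := lt_of_lt_of_le (by positivity) hα
    exact_mod_cast h1
  refine iSup_le fun s => iSup_le fun hs => iSup_le fun hG => ?_
  have h1 := SimpleGraph.cost_le_of_stable (hs.addStable hG) (hs.deleteStable hα0 hG) hG hc hcard
    (by simpa using hα)
  rw [← Real.coe_toNNReal (2 + 5 * (936 * (2 + 2 / √c) / √c)) (by positivity), ← hA] at h1
  have h2 : α * (NetworkCreation.createdGraph α s).edgeSet.ncard +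
      (NetworkCreation.createdGraph α s).distSum ≤ A * (α * Fintype.card (Fin n)) := by
    exact_mod_cast h1
  rw [NetworkCreation.totalCost_eq hG]
  calc (α * ((NetworkCreation.createdGraph α s).edgeSet.ncard : ℝ≥0∞) +
        ((NetworkCreation.createdGraph α s).distSum : ℝ≥0∞))
      ≤ A * (α * Fintype.card (Fin n)) := by exact_mod_cast h2
    _ ≤ A * (2 * NetworkCreation.socialOptimum (⊤ : SimpleGraph (Fin n)) α) := by
        exact mul_le_mul_right (NetworkCreation.le_two_mul_socialOptimum hcard) _
    _ = _ := by push_cast; rw [mul_assoc]
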